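/- Let $\mathcal Y,\mathcal Z$ be measurable spaces and $\mathcal X,\mathcal U$ standard Borel spaces. Let $P_{Y,X}$ be a probability measure on $\mathcal Y\times\mathcal X$, $P_U$ a probability measure on $\mathcal U$, and $c_{\mathcal X}:\mathcal X\times\mathcal X\to[0,\infty)$ a measurable cost. For probability measures $\mu,\nu$ on $\mathcal X$ put $$W_{c_{\mathcal X}}(\mu,\nu)=\inf_{\gamma}\int c_{\mathcal X}\,d\gamma\in[0,\infty],$$ the infimum being over all couplings $\gamma$ of $\mu$ and $\nu$. Let $\Phi_{\mathcal Y}^*:\mathcal Y\to\mathcal Z$ (the encoder) and $\overline G_{\mathcal X}:\mathcal Z\times\mathcal U\to\mathcal X$ (the decoder) be measurable. With $(Y,X)\sim P_{Y,X}$ and $Z=\Phi_{\mathcal Y}^*(Y)$, let $P_{Z,X}$ be the law of $(Z,X)$, $P_Z=\Phi_{\mathcal Y}^*\#P_Y$ the law of $Z$, and $P_{X\mid Z=z}$ the regular conditional distribution of $X$ given $Z=z$. **Theorem.** The function $z\mapsto W_{c_{\mathcal X}}\bigl(P_{X\mid Z=z},\overline G_{\mathcal X}(z,\cdot)\#P_U\bigr)$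 is $P_Z$-a.e. equal to a measurable function, so that the latent conditional optimal transport cost $$\mathcal R_Z(\overline G_{\mathcal X};\Phi_{\mathcal Y}^*)=\int_{\mathcal Z}W_{c_{\mathcal X}}\bigl(P_{X\mid Z=z},\overline G_{\mathcal X}(z,\cdot)\#P_U\bigr)\,P_Z(dz)\in[0,\infty]$$ is well defined, and $$\mathcal R_Z(\overline G_{\mathcal X};\Phi_{\mathcal Y}^*)=\inf_{Q\,:\,Q_{Z,U}=P_Z\otimes P_U}\ \mathbb E\,c_{\mathcal X}\bigl(X,\overline G_{\mathcal X}(Z,U)\bigr),\qquad (Z,X)\sim P_{Z,X},\quad U\sim Q_{U\mid Z,X}.$$ Here the infimum is over all Markov kernels $Q_{U\mid Z,X}$ from $\mathcal Z\times\mathcal X$ to $\mathcal U$ for which the aggregated posterior of the associated block-triangular encoder, which copies $Z$, $$Q_{Z',U\mid Z=z,X=x}=\delta_z\otimes Q_{U\mid Z=z,X=x},\qquad Q_{Z,U}=\int_{\mathcal Z\times\mathcal X}Q_{Z',U\mid Z=z,X=x}\,P_{Z,X}(dz,dx),$$ satisfies $Q_{Z,U}=P_Z\otimes P_U$. -/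

import Mathlib

open MeasureTheory ProbabilityTheory
open scoped ENNReal NNReal

namespace CWAE

noncomputable section

/-- The optimal transport cost `W_c(μ, ν)`: the infimum of `∫ c dγ` over all couplings `γ` of
`μ` and `ν`. -/
def otCost {𝒳 : Type*} [MeasurableSpace 𝒳] (c : 𝒳 × 𝒳 → ℝ≥0) (μ ν : Measure 𝒳) : ℝ≥0∞ :=
  ⨅ (γ : Measure (𝒳 × 𝒳)) (_ : γ.fst = μ) (_ : γ.snd = ν), ∫⁻ p, (c p : ℝ≥0∞) ∂γ

/-- The law `P_{Z,X}` of `(Z, X) = (Φ(Y), X)` when `(Y, X) ∼ P_{Y,X}`. Its first marginal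
`(latentCoupling P Φ).fst` is `P_Z`, the law of `Z = Φ(Y)`. -/
def latentCoupling {𝒴 𝒳 𝒵 : Type*} [MeasurableSpace 𝒴] [MeasurableSpace 𝒳] [MeasurableSpace 𝒵]
    (P : Measure (𝒴 × 𝒳)) (Φ : 𝒴 → 𝒵) : Measure (𝒵 × 𝒳) :=
  P.map (fun p => (Φ p.1, p.2))

/-- The conditional discrepancy `z ↦ W_c(P_{X|Z=z}, G(z, ·)#P_U)`, where `P_{X|Z}` is the regular
conditional distribution of `X` given `Z` under `P_{Z,X}`. -/
def conditionalDiscrepancy {𝒳 𝒵 𝒰 : Type*} [MeasurableSpace 𝒳] [StandardBorelSpace 𝒳]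
    [Nonempty 𝒳] [MeasurableSpace 𝒵] [MeasurableSpace 𝒰] (c : 𝒳 × 𝒳 → ℝ≥0)
    (PZX : Measure (𝒵 × 𝒳)) [IsFiniteMeasure PZX] (PU : Measure 𝒰) (G : 𝒵 × 𝒰 → 𝒳)
    (z : 𝒵) : ℝ≥0∞ :=
  otCost c (PZX.condKernel z) (PU.map (fun u => G (z, u)))

/-- The latent conditional OT cost
`R_Z(G; Φ) = ∫ W_c(P_{X|Z=z}, G(z, ·)#P_U) P_Z(dz)`, as a functional of the coupling `P_{Z,X}`
induced by the encoder `Φ`. -/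
def latentConditionalCost {𝒳 𝒵 𝒰 : Type*} [MeasurableSpace 𝒳] [StandardBorelSpace 𝒳]
    [Nonempty 𝒳] [MeasurableSpace 𝒵] [MeasurableSpace 𝒰] (c : 𝒳 × 𝒳 → ℝ≥0)
    (PZX : Measure (𝒵 × 𝒳)) [IsFiniteMeasure PZX] (PU : Measure 𝒰) (G : 𝒵 × 𝒰 → 𝒳) : ℝ≥0∞ :=
  ∫⁻ z, conditionalDiscrepancy c PZX PU G z ∂PZX.fst

/-- The block-triangular encoder `Q_{Z',U|Z,X} = δ_Z(dZ') Q_{U|Z,X}(dU)` built from a stochastic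
encoder `Q_{U|Z,X}`. -/
def blockTriangularEncoder {𝒳 𝒵 𝒰 : Type*} [MeasurableSpace 𝒳] [MeasurableSpace 𝒵]
    [MeasurableSpace 𝒰] (Q : Kernel (𝒵 × 𝒳) 𝒰) : Kernel (𝒵 × 𝒳) (𝒵 × 𝒰) :=
  Kernel.deterministic Prod.fst measurable_fst ×ₖ Q

/-- The aggregated posterior `Q_{Z,U} = ∫ Q_{Z',U|Z=z,X=x} P_{Z,X}(dz, dx)`. -/
def aggregatedPosterior {𝒳 𝒵 𝒰 : Type*} [MeasurableSpace 𝒳] [MeasurableSpace 𝒵]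
    [MeasurableSpace 𝒰] (PZX : Measure (𝒵 × 𝒳)) (Q : Kernel (𝒵 × 𝒳) 𝒰) : Measure (𝒵 × 𝒰) :=
  PZX.bind (blockTriangularEncoder Q)

/-- The reconstruction error `E c(X, G(Z, U))`, where `(Z, X) ∼ P_{Z,X}` and
`U ∼ Q_{U|Z,X}`. -/
def reconstructionError {𝒳 𝒵 𝒰 : Type*} [MeasurableSpace 𝒳] [MeasurableSpace 𝒵]
    [MeasurableSpace 𝒰] (c : 𝒳 × 𝒳 → ℝ≥0) (PZX : Measure (𝒵 × 𝒳)) (Q : Kernel (𝒵 × 𝒳) 𝒰)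
    (G : 𝒵 × 𝒰 → 𝒳) : ℝ≥0∞ :=
  ∫⁻ q : (𝒵 × 𝒳) × 𝒰, (c (q.1.2, G (q.1.1, q.2)) : ℝ≥0∞) ∂(PZX.compProd Q)

instance latentCoupling_isFiniteMeasure {𝒴 𝒳 𝒵 : Type*} [MeasurableSpace 𝒴] [MeasurableSpace 𝒳] [MeasurableSpace 𝒵]
    (P : Measure (𝒴 × 𝒳)) [IsFiniteMeasure P] (Φ : 𝒴 → 𝒵) :
    IsFiniteMeasure (latentCoupling P Φ) := by
  unfold latentCoupling; infer_instance

end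

end CWAE

/-! Disintegrate everything along `Z`. For an admissible `Q`, the law of `(X, U)` given `Z = z`
couples `P_{X|Z=z}` with `P_U` for almost every `z`; pushing it forward by `(x, u) ↦ (x, G (z, u))`
gives a competitor for `W_c`, and integration over `z` yields `≤`.

Conversely, a coupling of `P_{X|Z=z}` with `G(z, ·)#P_U` lifts to one with `P_U` at equal cost
(`exists_lift_coupling`). So `W_c` is an infimum over couplings on `𝒳 × 𝒰`, which
`exists_universal_kernel` parametrises by the standard Borel space `ℚ → ℝ`.
`exists_measurable_selection` then gives both a.e. measurability and near-optimal couplings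
measurable in `z`; conditioning these on `X` produces the encoder. -/

namespace CWAE

/-! ### Measurable selection almost everywhere -/

section Selection

open Set Filter Topology

/-- A product-measurable set depends on only countably many measurable sets of `W`, and `φ` records
their indicators. This replaces an arbitrary `W` by Cantor space, so that `𝒵` need not be standard
Borel. -/
theorem exists_measurable_factor {W T : Type*} [MeasurableSpace W] [MeasurableSpace T]
    {S : Set (W × T)} (hS : MeasurableSet S) :
    ∃ φ : W → (ℕ → Bool), Measurable φ ∧
      ∃ S' : Set ((ℕ → Bool) × T), MeasurableSet S' ∧ S = Prod.map φ id ⁻¹' S' := by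
  classical
  have hS' : MeasurableSet[MeasurableSpace.generateFrom
      (image2 (· ×ˢ ·) {s : Set W | MeasurableSet s} {t : Set T | MeasurableSet t})] S := by
    rw [generateFrom_prod]; exact hS
  induction S, hS' using MeasurableSpace.generateFrom_induction with
  | hC t ht _ =>
    obtain ⟨A, hA, B, hB, rfl⟩ := ht
    have hA : MeasurableSet A := hA
    refine ⟨fun w _ => decide (w ∈ A), ?_, {y | y 0 = true} ×ˢ B, ?_, ?_⟩
    · refine measurable_pi_iff.2 fun _ => measurable_to_bool ?_
      convert hA using 1
      ext w; simp
    · exact ((measurable_pi_apply (X := fun _ : ℕ => Bool) 0)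
        (measurableSet_singleton true)).prod hB
    · ext ⟨w, t⟩; simp
  | empty => exact ⟨fun _ _ => false, measurable_const, ∅, .empty, by simp⟩
  | compl t _ ih =>
    obtain ⟨φ, hφ, S', hS', h⟩ := ih (by rw [← generateFrom_prod]; assumption)
    exact ⟨φ, hφ, S'ᶜ, hS'.compl, by rw [h]; rfl⟩
  | iUnion s hs ih =>
    choose φ hφ S' hS' h using fun n => ih n (by rw [← generateFrom_prod]; exact hs n)
    refine ⟨fun w k => φ k.unpair.1 w k.unpair.2, ?_,
      ⋃ n, Prod.map (fun y k => y (Nat.pair n k)) id ⁻¹' S' n, ?_, ?_⟩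
    · exact measurable_pi_iff.2 fun k => (measurable_pi_apply _).comp (hφ _)
    · refine .iUnion fun n => ?_
      refine Measurable.prodMap ?_ measurable_id (hS' n)
      exact measurable_pi_iff.2 fun k => measurable_pi_apply _
    · rw [preimage_iUnion]
      refine iUnion_congr fun n => ?_
      conv_lhs => rw [h n]
      ext ⟨w, t⟩; simp

theorem isCompact_box (n : ℕ → ℕ) : IsCompact {x : ℕ → ℕ | ∀ i, x i ≤ n i} := by
  have := isCompact_univ_pi (fun i => (finite_Iic (n i)).isCompact)
  convert this using 1
  ext x; simp [Pi.le_def]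

/-- A neighbourhood of the compact box `∏ i, {0, …, n i}` in Baire space contains all sequences
obeying a sufficiently long finite part of its constraints. -/
theorem exists_box_subset_of_isOpen {n : ℕ → ℕ} {V : Set (ℕ → ℕ)} (hV : IsOpen V)
    (hK : {x : ℕ → ℕ | ∀ i, x i ≤ n i} ⊆ V) : ∃ k, {x : ℕ → ℕ | ∀ i < k, x i ≤ n i} ⊆ V := by
  by_contra! hcon
  choose y hy hyV using fun k => not_subset.1 (hcon k)
  -- Truncation puts `y k` in the compact box and leaves its coordinates below `k` unchanged, so
  -- both sequences have the same limit along `φ`.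
  obtain ⟨x, hx, φ, hφ, hlim⟩ := (isCompact_box n).tendsto_subseq (x := fun k i => min (y k i) (n i))
    (fun k i => min_le_right _ _)
  have hy_lim : Tendsto (fun k => y (φ k)) atTop (𝓝 x) := by
    rw [tendsto_pi_nhds] at hlim ⊢
    intro i
    refine (hlim i).congr' ?_
    filter_upwards [eventually_gt_atTop i] with k hk
    exact min_eq_left (hy (φ k) i (hk.trans_le (hφ.id_le k)))
  exact hV.isClosed_compl.mem_of_tendsto hy_lim (.of_forall fun k => hyV _) (hK hx)

/-- Inner regularity of continuous images of Baire space. -/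
theorem exists_isCompact_lt_measure_image {W : Type*} [TopologicalSpace W] [MeasurableSpace W]
    (μ : Measure W) [μ.OuterRegular] {f : (ℕ → ℕ) → W} (hf : Continuous f) {r : ℝ≥0∞}
    (hr : r < μ (range f)) : ∃ K : Set (ℕ → ℕ), IsCompact K ∧ r ≤ μ (f '' K) := by
  -- Continuity from below holds for arbitrary increasing sets, so a large enough bound on
  -- coordinate `k` keeps the measure of the image above `r`.
  have step : ∀ (k : ℕ) (D : {D : Set (ℕ → ℕ) // r < μ (f '' D)}),
      ∃ m : ℕ, r < μ (f '' (D.1 ∩ {x | x k ≤ m})) := by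
    rintro k ⟨D, hD⟩
    have hmono : Monotone fun m : ℕ => f '' (D ∩ {x | x k ≤ m}) := fun a b hab =>
      image_mono (inter_subset_inter_right _ fun x (hx : x k ≤ a) => hx.trans hab)
    have hU : f '' D = ⋃ m : ℕ, f '' (D ∩ {x | x k ≤ m}) := by
      rw [← image_iUnion, ← inter_iUnion]
      congr 1
      ext x
      simp only [mem_inter_iff, mem_iUnion, mem_ofPred_eq]
      exact ⟨fun h => ⟨h, x k, le_rfl⟩, fun h => h.1⟩
    rw [hU, hmono.measure_iUnion] at hD
    exact lt_iSup_iff.1 hD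
  choose m hm using step
  let D : ℕ → {D : Set (ℕ → ℕ) // r < μ (f '' D)} := fun k =>
    Nat.rec ⟨univ, by rwa [image_univ]⟩ (fun k D => ⟨D.1 ∩ {x | x k ≤ m k D}, hm k D⟩) k
  let n : ℕ → ℕ := fun k => m k (D k)
  have hD : ∀ k, (D k).1 = {x | ∀ i < k, x i ≤ n i} := by
    intro k
    induction k with
    | zero => ext x; simp [D]
    | succ k ih =>
      have : (D (k + 1)).1 = (D k).1 ∩ {x | x k ≤ n k} := rfl
      rw [this, ih]
      ext x
      simp only [mem_inter_iff, mem_ofPred_eq]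
      exact (Nat.forall_lt_succ_right (p := fun i => x i ≤ n i)).symm
  refine ⟨{x | ∀ i, x i ≤ n i}, isCompact_box n, ?_⟩
  rw [Set.measure_eq_iInf_isOpen]
  refine le_iInf fun V => le_iInf fun hKV => le_iInf fun hV => ?_
  obtain ⟨k, hk⟩ := exists_box_subset_of_isOpen (hV.preimage hf) (image_subset_iff.1 hKV)
  refine (D k).2.le.trans (measure_mono (image_subset_iff.2 ?_))
  rw [hD k]; exact hk

/-- Select the least point of each fibre: its sublevel sets are, over the projection of `C`,
projections of compact sets. -/
theorem exists_measurable_selection_of_isCompact {W : Type*} [TopologicalSpace W] [T2Space W]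
    [MeasurableSpace W] [OpensMeasurableSpace W] {C : Set (W × ℝ)} (hC : IsCompact C) :
    ∃ s : W → ℝ, Measurable s ∧ ∀ w ∈ Prod.fst '' C, (w, s w) ∈ C := by
  classical
  have hcl : IsClosed C := hC.isClosed
  have hmem : ∀ w ∈ Prod.fst '' C, sInf {t | (w, t) ∈ C} ∈ {t | (w, t) ∈ C} := by
    rintro w ⟨⟨w', t⟩, ht, rfl⟩
    refine IsClosed.csInf_mem (hcl.preimage (by fun_prop)) ⟨t, ht⟩ ?_
    exact (hC.image continuous_snd).bddBelow.mono fun t' ht' => mem_image_of_mem Prod.snd ht'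
  have hbdd : ∀ w, BddBelow {t | (w, t) ∈ C} := fun w =>
    (hC.image continuous_snd).bddBelow.mono fun t' ht' => mem_image_of_mem Prod.snd ht'
  have hA : MeasurableSet (Prod.fst '' C) := (hC.image continuous_fst).measurableSet
  refine ⟨(Prod.fst '' C).piecewise (fun w => sInf {t | (w, t) ∈ C}) 0, ?_, fun w hw => ?_⟩
  · refine measurable_of_Iic fun a => ?_
    have hB : MeasurableSet (Prod.fst '' (C ∩ Prod.snd ⁻¹' Iic a)) :=
      ((hC.inter_right (isClosed_Iic.preimage continuous_snd)).image
        continuous_fst).measurableSet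
    have : (Prod.fst '' C).piecewise (fun w => sInf {t | (w, t) ∈ C}) 0 ⁻¹' Iic a =
        Prod.fst '' (C ∩ Prod.snd ⁻¹' Iic a) ∪ ((Prod.fst '' C)ᶜ ∩ {_w | 0 ≤ a}) := by
      ext w
      by_cases hw : w ∈ Prod.fst '' C
      · simp only [mem_preimage, piecewise_eq_of_mem _ _ _ hw, mem_Iic, mem_union, mem_inter_iff,
          mem_compl_iff, hw, not_true, false_and, or_false]
        constructor
        · exact fun h => ⟨_, ⟨hmem w hw, h⟩, rfl⟩
        · rintro ⟨⟨w', t⟩, ⟨ht, hta⟩, rfl⟩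
          exact (csInf_le (hbdd _) ht).trans hta
      · simp only [mem_preimage, piecewise_eq_of_notMem _ _ _ hw, mem_Iic, mem_union,
          mem_inter_iff, mem_compl_iff, hw, not_false_eq_true, true_and, mem_ofPred_eq,
          Pi.zero_apply]
        refine ⟨Or.inr, fun h => h.resolve_left fun ⟨p, hp, hpw⟩ => hw ⟨p, hp.1, hpw⟩⟩
    rw [this]
    exact hB.union (hA.compl.inter (.const _))
  · rw [piecewise_eq_of_mem _ _ _ hw]
    exact hmem w hw

/-- `S` is a continuous image of Baire space, so countably many compact pieces of `S` have
projections exhausting that of `S` up to a null set. Their least-point selections are glued along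
the disjointed projections. -/
theorem exists_measurable_selection_real {W : Type*} [MeasurableSpace W] [StandardBorelSpace W]
    (μ : Measure W) [IsFiniteMeasure μ] {S : Set (W × ℝ)} (hS : MeasurableSet S) :
    NullMeasurableSet (Prod.fst '' S) μ ∧
      ∃ s : W → ℝ, Measurable s ∧ ∀ᵐ w ∂μ, w ∈ Prod.fst '' S → (w, s w) ∈ S := by
  let := upgradeStandardBorel W
  have hSan := hS.analyticSet
  rw [AnalyticSet] at hSan
  rcases hSan with rfl | ⟨f, hf, hfS⟩
  · simpa using ⟨0, measurable_zero⟩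
  obtain ⟨e, he⟩ := exists_surjective_nat ℚ
  have hKex : ∀ n : ℕ, ∃ K : Set (ℕ → ℕ), IsCompact K ∧
      ((Real.toNNReal (e n) : ℝ≥0∞) < μ (Prod.fst '' S) →
        (Real.toNNReal (e n) : ℝ≥0∞) ≤ μ ((Prod.fst ∘ f) '' K)) := by
    intro n
    by_cases h : (Real.toNNReal (e n) : ℝ≥0∞) < μ (Prod.fst '' S)
    · obtain ⟨K, hK, hK'⟩ := exists_isCompact_lt_measure_image μ (continuous_fst.comp hf)
        (by rwa [range_comp, hfS])
      exact ⟨K, hK, fun _ => hK'⟩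
    · exact ⟨∅, isCompact_empty, fun h' => absurd h' h⟩
  choose K hK hrK using hKex
  have hC : ∀ n, IsCompact (f '' K n) := fun n => (hK n).image hf
  have hCS : ∀ n, f '' K n ⊆ S := fun n => hfS ▸ image_subset_range _ _
  choose s hs hsC using fun n => exists_measurable_selection_of_isCompact (hC n)
  have hA : ∀ n, MeasurableSet (Prod.fst '' (f '' K n)) := fun n =>
    ((hC n).image continuous_fst).measurableSet
  have hsub : (⋃ n, Prod.fst '' (f '' K n)) ⊆ Prod.fst '' S :=
    iUnion_subset fun n => image_mono (hCS n)
  have hle : μ (Prod.fst '' S) ≤ μ (⋃ n, Prod.fst '' (f '' K n)) := by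
    refine le_of_forall_lt fun b hb => ?_
    obtain ⟨q, -, hbq, hq⟩ := ENNReal.lt_iff_exists_rat_btwn.1 hb
    obtain ⟨n, rfl⟩ := he q
    have := hrK n hq
    rw [image_comp] at this
    exact hbq.trans_le (this.trans (measure_mono (subset_iUnion_of_subset _ subset_rfl)))
  have hae : (⋃ n, Prod.fst '' (f '' K n) : Set W) =ᵐ[μ] Prod.fst '' S :=
    ae_eq_of_subset_of_measure_ge hsub hle (MeasurableSet.iUnion hA).nullMeasurableSet
      (measure_ne_top _ _)
  refine ⟨(MeasurableSet.iUnion hA).nullMeasurableSet.congr hae, ?_⟩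
  obtain ⟨g, hg, hgs⟩ := exists_measurable_piecewise
    (disjointed fun n => Prod.fst '' (f '' K n)) (fun n => .disjointed hA n) s hs
    (fun i j hij w hw => (disjoint_left.1 (disjoint_disjointed _ hij) hw.1 hw.2).elim)
  refine ⟨g, hg, ?_⟩
  filter_upwards [hae.mem_iff] with w hw hwS
  rw [← hw, ← iUnion_disjointed, mem_iUnion] at hwS
  obtain ⟨n, hn⟩ := hwS
  rw [hgs n hn]
  exact hCS n (hsC n w (disjointed_subset (fun n => Prod.fst '' (f '' K n)) n hn))

/-- **Measurable selection** (Jankov–von Neumann, almost everywhere version). -/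
theorem exists_measurable_selection {W T : Type*} [MeasurableSpace W] [MeasurableSpace T]
    [StandardBorelSpace T] [Nonempty T] (μ : Measure W) [IsFiniteMeasure μ] {S : Set (W × T)}
    (hS : MeasurableSet S) :
    NullMeasurableSet (Prod.fst '' S) μ ∧
      ∃ s : W → T, Measurable s ∧ ∀ᵐ w ∂μ, w ∈ Prod.fst '' S → (w, s w) ∈ S := by
  obtain ⟨φ, hφ, S', hS', rfl⟩ := exists_measurable_factor hS
  have he : MeasurableEmbedding (embeddingReal T) := measurableEmbedding_embeddingReal T
  obtain ⟨e', he', hinv⟩ := he.exists_measurable_extend measurable_id fun _ => ‹Nonempty T›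
  have hee : ∀ t, e' (embeddingReal T t) = t := congr_fun hinv
  have hS'' : MeasurableSet (Prod.map id (embeddingReal T) '' S') :=
    (MeasurableEmbedding.id.prodMap he).measurableSet_image.2 hS'
  obtain ⟨hnull, s, hs, hsS⟩ := exists_measurable_selection_real (μ.map φ) hS''
  have himg : Prod.fst '' (Prod.map φ id ⁻¹' S') =
      φ ⁻¹' (Prod.fst '' (Prod.map id (embeddingReal T) '' S')) := by
    ext w
    simp
  refine ⟨?_, fun w => e' (s (φ w)), he'.comp (hs.comp hφ), ?_⟩
  · rw [himg]
    exact hnull.preimage ⟨hφ, .rfl⟩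
  · filter_upwards [ae_of_ae_map hφ.aemeasurable hsS] with w hw hwS
    rw [himg] at hwS
    obtain ⟨⟨y, t⟩, hyt, h⟩ := hw hwS
    simp only [Prod.map_apply, id_eq, Prod.mk.injEq] at h
    obtain ⟨rfl, h⟩ := h
    simp only [mem_preimage, Prod.map_apply, id_eq, ← h, hee]
    exact hyt

end Selection

/-! ### Measurable near-minimizers -/

section NearMinimizer

open Set

/-- The set where the infimum is below `a` is the projection of a measurable set. -/
theorem aemeasurable_iInf_mem {W T : Type*} [MeasurableSpace W] [MeasurableSpace T]
    [StandardBorelSpace T] [Nonempty T] (μ : Measure W) [IsFiniteMeasure μ] {F : Set (W × T)}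
    (hF : MeasurableSet F) {h : W × T → ℝ≥0∞} (hh : Measurable h) :
    AEMeasurable (fun w => ⨅ (t : T) (_ : (w, t) ∈ F), h (w, t)) μ := by
  have : NullMeasurable (fun w => ⨅ (t : T) (_ : (w, t) ∈ F), h (w, t)) μ := by
    refine measurable_of_Iio (α := ℝ≥0∞) (δ := NullMeasurableSpace W μ) fun a => ?_
    have heq : (fun w => ⨅ (t : T) (_ : (w, t) ∈ F), h (w, t)) ⁻¹' Iio a =
        Prod.fst '' (F ∩ h ⁻¹' Iio a) := by
      ext w
      simp [iInf_lt_iff]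
    exact heq ▸ (exists_measurable_selection μ (hF.inter (hh measurableSet_Iio))).1
  exact this.aemeasurable

theorem exists_measurable_near_minimizer {W T : Type*} [MeasurableSpace W] [MeasurableSpace T]
    [StandardBorelSpace T] [Nonempty T] (μ : Measure W) [IsFiniteMeasure μ] {F : Set (W × T)}
    (hF : MeasurableSet F) (hne : ∀ w, ∃ t, (w, t) ∈ F) {h : W × T → ℝ≥0∞} (hh : Measurable h)
    {ε : ℝ≥0∞} (hε : ε ≠ 0) :
    ∃ s : W → T, Measurable s ∧ ∀ᵐ w ∂μ, (w, s w) ∈ F ∧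
      h (w, s w) ≤ (⨅ (t : T) (_ : (w, t) ∈ F), h (w, t)) + ε := by
  have hV := aemeasurable_iInf_mem μ hF hh
  -- A measurable version of the infimum makes the set of near-minimizers measurable.
  obtain ⟨s, hs, hsS⟩ := (exists_measurable_selection μ (hF.inter
    (measurableSet_le hh ((hV.measurable_mk.comp measurable_fst).add_const ε)))).2
  refine ⟨s, hs, ?_⟩
  filter_upwards [hsS, hV.ae_eq_mk] with w hw hVw
  have hex : ∃ t, (w, t) ∈ F ∧ h (w, t) ≤ (⨅ (t : T) (_ : (w, t) ∈ F), h (w, t)) + ε := by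
    by_cases htop : (⨅ (t : T) (_ : (w, t) ∈ F), h (w, t)) = ⊤
    · obtain ⟨t, ht⟩ := hne w
      exact ⟨t, ht, by simp [htop]⟩
    · have hlt := ENNReal.lt_add_right htop hε
      obtain ⟨t, hlt⟩ := iInf_lt_iff.1 hlt
      obtain ⟨ht, hlt⟩ := iInf_lt_iff.1 hlt
      exact ⟨t, ht, hlt.le⟩
  obtain ⟨t, ht, hle⟩ := hex
  have := hw ⟨(w, t), ⟨ht, by simpa [← hVw] using hle⟩, rfl⟩
  exact ⟨this.1, by simpa [← hVw] using this.2⟩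

end NearMinimizer

/-! ### Parametrising probability measures -/

section UniversalKernel

open Set Filter Topology

theorem isRatStieltjesPoint_cdf (μ : Measure ℝ) :
    IsRatStieltjesPoint (id : (ℚ → ℝ) → ℚ → ℝ) (fun q => cdf μ q) where
  mono q r hqr := monotone_cdf μ (by exact_mod_cast hqr)
  tendsto_atTop_one := (tendsto_cdf_atTop μ).comp (tendsto_ratCast_atTop_iff.2 tendsto_id)
  tendsto_atBot_zero := (tendsto_cdf_atBot μ).comp (tendsto_ratCast_atBot_iff.2 tendsto_id)
  iInf_rat_gt_eq q := by
    rw [id, ← (cdf μ).iInf_rat_gt_eq q]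
    exact Equiv.iInf_congr (Equiv.subtypeEquivRight fun r => by simp) fun _ => rfl

/-- Every probability measure on a standard Borel space is the value of one fixed Markov kernel,
whose parameter is the restriction of a distribution function to the rationals. -/
theorem exists_universal_kernel (V : Type*) [MeasurableSpace V] [StandardBorelSpace V]
    [Nonempty V] : ∃ K : Kernel (ℚ → ℝ) V, IsMarkovKernel K ∧
      ∀ μ : Measure V, IsProbabilityMeasure μ → ∃ t, K t = μ := by
  have he : MeasurableEmbedding (embeddingReal V) := measurableEmbedding_embeddingReal V
  obtain ⟨e', he', hinv⟩ := he.exists_measurable_extend measurable_id fun _ => ‹Nonempty V›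
  have hid : Measurable (id : (ℚ → ℝ) → ℚ → ℝ) := measurable_id
  -- Parameters that are not restrictions of a distribution function get a default one, so `K` is
  -- Markov everywhere.
  let K : Kernel (ℚ → ℝ) ℝ := ⟨_, measurable_measure_stieltjesOfMeasurableRat hid⟩
  have hK : IsMarkovKernel K := ⟨fun t => ⟨measure_stieltjesOfMeasurableRat_univ hid t⟩⟩
  refine ⟨K.map e', Kernel.IsMarkovKernel.map K he', fun μ hμ => ?_⟩
  have hμ' : IsProbabilityMeasure (μ.map (embeddingReal V)) :=
    Measure.isProbabilityMeasure_map he.measurable.aemeasurable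
  refine ⟨fun q => cdf (μ.map (embeddingReal V)) q, ?_⟩
  have hKt : K (fun q => cdf (μ.map (embeddingReal V)) q) = μ.map (embeddingReal V) := by
    rw [← measure_cdf (μ.map (embeddingReal V))]
    change (stieltjesOfMeasurableRat _ hid _).measure = _
    congr 1
    ext x
    rw [← StieltjesFunction.iInf_rat_gt_eq, ← StieltjesFunction.iInf_rat_gt_eq]
    refine iInf_congr fun r => ?_
    rw [stieltjesOfMeasurableRat_eq,
      toRatCDF_of_isRatStieltjesPoint (isRatStieltjesPoint_cdf _)]
    simp [measure_cdf]
  rw [Kernel.map_apply _ he', hKt, Measure.map_map he' he.measurable, hinv, Measure.map_id]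

/-- After embedding in `ℝ`, equality need only be tested on the countably many rational half-lines.
-/
theorem measurableSet_eq_measure {W V : Type*} [MeasurableSpace W] [MeasurableSpace V]
    [StandardBorelSpace V] (f g : Kernel W V) [IsMarkovKernel f] [IsMarkovKernel g] :
    MeasurableSet {w | f w = g w} := by
  have he : MeasurableEmbedding (embeddingReal V) := measurableEmbedding_embeddingReal V
  have heq : {w | f w = g w} =
      ⋂ q : ℚ, {w | f w (embeddingReal V ⁻¹' Iic (q : ℝ)) =
        g w (embeddingReal V ⁻¹' Iic (q : ℝ))} := by
    ext w
    simp only [mem_ofPred_eq, mem_iInter]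
    refine ⟨fun h q => by rw [h], fun h => ?_⟩
    have hmap : (f w).map (embeddingReal V) = (g w).map (embeddingReal V) := by
      refine ext_of_generate_finite _
        ((BorelSpace.measurable_eq (α := ℝ)).trans Real.borel_eq_generateFrom_Iic_rat)
        Real.isPiSystem_Iic_rat ?_ ?_
      · intro s hs
        obtain ⟨q, rfl⟩ := mem_iUnion.1 hs
        simpa [he.map_apply] using h q
      · simp [he.map_apply]
    rw [← he.comap_map (f w), hmap, he.comap_map]
  rw [heq]
  exact .iInter fun q => measurableSet_eq_fun
    (Kernel.measurable_coe f (he.measurable measurableSet_Iic))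
    (Kernel.measurable_coe g (he.measurable measurableSet_Iic))

end UniversalKernel

/-! ### Lifting couplings along the decoder -/

section Gluing

variable {𝒳 𝒰 : Type*} [MeasurableSpace 𝒳] [MeasurableSpace 𝒰]

theorem otCost_le_lintegral {c : 𝒳 × 𝒳 → ℝ≥0} (hc : Measurable c) {PU : Measure 𝒰} {g : 𝒰 → 𝒳}
    (hg : Measurable g) (θ : Measure (𝒳 × 𝒰)) (hθ : θ.snd = PU) :
    otCost c θ.fst (PU.map g) ≤ ∫⁻ p, c (p.1, g p.2) ∂θ := by
  have hm : Measurable (fun p : 𝒳 × 𝒰 => (p.1, g p.2)) := by fun_prop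
  refine (iInf_le_of_le (θ.map fun p => (p.1, g p.2)) (iInf₂_le ?_ ?_)).trans_eq ?_
  · rw [Measure.fst, Measure.map_map measurable_fst hm]; rfl
  · rw [← hθ, Measure.snd, Measure.snd, Measure.map_map measurable_snd hm,
      Measure.map_map hg measurable_snd]; rfl
  · rw [lintegral_map (by fun_prop) hm]

/-- A coupling of `μ` and `PU.map g` lifts along `g` to a coupling of `μ` and `PU`. -/
theorem exists_lift_coupling [StandardBorelSpace 𝒳] [StandardBorelSpace 𝒰] {PU : Measure 𝒰}
    [IsProbabilityMeasure PU] {g : 𝒰 → 𝒳} (hg : Measurable g) (γ : Measure (𝒳 × 𝒳))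
    (hγ : γ.snd = PU.map g) {c : 𝒳 × 𝒳 → ℝ≥0∞} (hc : Measurable c) :
    ∃ θ : Measure (𝒳 × 𝒰), θ.fst = γ.fst ∧ θ.snd = PU ∧
      ∫⁻ p, c (p.1, g p.2) ∂θ = ∫⁻ p, c p ∂γ := by
  have : Nonempty 𝒰 := nonempty_of_isProbabilityMeasure PU
  have hm : Measurable fun u => (g u, u) := by fun_prop
  let ρ : Measure (𝒳 × 𝒰) := PU.map fun u => (g u, u)
  have hρ : IsProbabilityMeasure ρ := Measure.isProbabilityMeasure_map hm.aemeasurable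
  have hρfst : ρ.fst = γ.snd := by
    rw [hγ, Measure.fst, Measure.map_map measurable_fst hm]; rfl
  have hγp : IsProbabilityMeasure γ := by
    have : IsProbabilityMeasure γ.snd := hρfst ▸ inferInstance
    exact ⟨by rw [← Measure.snd_univ, measure_univ]⟩
  -- Given a pair drawn from `γ`, draw `u` from its conditional law under `PU` given that `g u` is
  -- the second coordinate.
  let η : Kernel (𝒳 × 𝒳) 𝒰 := ρ.condKernel.comap Prod.snd measurable_snd
  have hπ : Measurable fun q : (𝒳 × 𝒳) × 𝒰 => (q.1.1, q.2) := by fun_prop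
  refine ⟨(γ ⊗ₘ η).map fun q => (q.1.1, q.2), ?_, ?_, ?_⟩
  · rw [Measure.fst, Measure.map_map measurable_fst hπ]
    conv_rhs => rw [← Measure.fst_compProd γ η, Measure.fst, Measure.fst,
      Measure.map_map measurable_fst measurable_fst]
    rfl
  · have h1 : (γ ⊗ₘ η).snd = ρ.snd := by
      conv_rhs => rw [← ρ.disintegrate ρ.condKernel, hρfst]
      ext s hs
      rw [Measure.snd_apply hs, Measure.snd_apply hs, Measure.compProd_apply (measurable_snd hs),
        Measure.compProd_apply (measurable_snd hs), Measure.snd, lintegral_map _ measurable_snd]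
      · rfl
      · exact Kernel.measurable_kernel_prodMk_left (measurable_snd hs)
    rw [Measure.snd, Measure.map_map measurable_snd hπ]
    refine Eq.trans (b := (γ ⊗ₘ η).snd) rfl (h1.trans ?_)
    rw [Measure.snd, Measure.map_map measurable_snd hm]
    exact Measure.map_id
  -- The conditional law is carried by the fibre of `g`, so replacing the second coordinate by `g u`
  -- does not change the cost.
  · have hae : ∀ᵐ x ∂γ.snd, ∀ᵐ u ∂ρ.condKernel x, g u = x := by
      rw [← hρfst]
      refine Measure.ae_ae_of_ae_compProd (p := fun p => g p.2 = p.1) ?_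
      rw [ρ.disintegrate ρ.condKernel]
      exact (ae_map_iff hm.aemeasurable
        (measurableSet_eq_fun (hg.comp measurable_snd) measurable_fst)).2 (.of_forall fun _ => rfl)
    rw [lintegral_map (by fun_prop) hπ, Measure.lintegral_compProd (by fun_prop)]
    refine lintegral_congr_ae ?_
    filter_upwards [ae_of_ae_map measurable_snd.aemeasurable hae] with p hp
    rw [lintegral_congr_ae (g := fun _ => c p)]
    · simp
    · filter_upwards [hp] with u hu
      rw [hu]

end Gluing

/-! ### Encoders and the latent cost -/

section LatentCost

open Set

variable {𝒳 𝒵 𝒰 : Type*} [MeasurableSpace 𝒵] [MeasurableSpace 𝒳] [StandardBorelSpace 𝒳]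
  [Nonempty 𝒳] [MeasurableSpace 𝒰]

theorem reconstructionError_eq_lintegral {c : 𝒳 × 𝒳 → ℝ≥0} (hc : Measurable c)
    (PZX : Measure (𝒵 × 𝒳)) [IsFiniteMeasure PZX] (Q : Kernel (𝒵 × 𝒳) 𝒰) [IsMarkovKernel Q]
    {G : 𝒵 × 𝒰 → 𝒳} (hG : Measurable G) :
    reconstructionError c PZX Q G =
      ∫⁻ z, ∫⁻ p, (c (p.1, G (z, p.2)) : ℝ≥0∞) ∂((PZX.condKernel ⊗ₖ Q) z) ∂PZX.fst := by
  rw [reconstructionError, Measure.lintegral_compProd (by fun_prop)]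
  conv_lhs => rw [← PZX.disintegrate PZX.condKernel]
  have hm : Measurable fun q : (𝒵 × 𝒳) × 𝒰 => (c (q.1.2, G (q.1.1, q.2)) : ℝ≥0∞) := by fun_prop
  rw [Measure.lintegral_compProd hm.lintegral_kernel_prod_right']
  refine lintegral_congr fun z => ?_
  rw [Kernel.lintegral_compProd _ _ _ (by fun_prop)]

theorem aggregatedPosterior_eq_compProd (PZX : Measure (𝒵 × 𝒳)) [IsFiniteMeasure PZX]
    (Q : Kernel (𝒵 × 𝒳) 𝒰) [IsMarkovKernel Q] :
    aggregatedPosterior PZX Q = PZX.fst ⊗ₘ (PZX.condKernel ⊗ₖ Q).snd := by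
  ext s hs
  have hpre : MeasurableSet {q : (𝒵 × 𝒳) × 𝒰 | (q.1.1, q.2) ∈ s} :=
    (show Measurable fun q : (𝒵 × 𝒳) × 𝒰 => (q.1.1, q.2) by fun_prop) hs
  have hQ : ∀ p : 𝒵 × 𝒳, blockTriangularEncoder Q p s = Q p (Prod.mk p.1 ⁻¹' s) := fun p => by
    rw [blockTriangularEncoder, Kernel.prod_apply, Kernel.deterministic_apply,
      Measure.prod_apply hs, lintegral_dirac' _ (measurable_measure_prodMk_left hs)]
  rw [aggregatedPosterior, Measure.bind_apply hs (Kernel.aemeasurable _),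
    Measure.compProd_apply hs]
  simp_rw [hQ]
  conv_lhs => rw [← PZX.disintegrate PZX.condKernel]
  have hm : Measurable fun p : 𝒵 × 𝒳 => Q p (Prod.mk p.1 ⁻¹' s) :=
    Kernel.measurable_kernel_prodMk_left hpre
  rw [Measure.lintegral_compProd hm]
  refine lintegral_congr fun z => ?_
  have hz : MeasurableSet (Prod.mk z ⁻¹' s) := measurable_prodMk_left hs
  rw [Kernel.snd_apply' _ _ hz, Kernel.compProd_apply (measurable_snd hz)]
  rfl

theorem conditionalDiscrepancy_le {c : 𝒳 × 𝒳 → ℝ≥0} (hc : Measurable c) (PZX : Measure (𝒵 × 𝒳))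
    [IsFiniteMeasure PZX] {PU : Measure 𝒰} {G : 𝒵 × 𝒰 → 𝒳} (hG : Measurable G) {z : 𝒵}
    {θ : Measure (𝒳 × 𝒰)} (hfst : θ.fst = PZX.condKernel z) (hsnd : θ.snd = PU) :
    conditionalDiscrepancy c PZX PU G z ≤ ∫⁻ p, c (p.1, G (z, p.2)) ∂θ := by
  rw [conditionalDiscrepancy, ← hfst]
  exact otCost_le_lintegral hc (hG.comp measurable_prodMk_left) θ hsnd

/-- After lifting, `G` enters only the cost and not the constraint, and the infimum runs over
parameters `t`, as selection requires. -/
theorem conditionalDiscrepancy_eq_iInf [StandardBorelSpace 𝒰] {c : 𝒳 × 𝒳 → ℝ≥0}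
    (hc : Measurable c) (PZX : Measure (𝒵 × 𝒳)) [IsFiniteMeasure PZX] {PU : Measure 𝒰}
    [IsProbabilityMeasure PU] {G : 𝒵 × 𝒰 → 𝒳} (hG : Measurable G) {T : Type*}
    {K : T → Measure (𝒳 × 𝒰)} (hK : ∀ μ, IsProbabilityMeasure μ → ∃ t, K t = μ) (z : 𝒵) :
    conditionalDiscrepancy c PZX PU G z =
      ⨅ (t : T) (_ : (z, t) ∈ {p : 𝒵 × T | (K p.2).fst = PZX.condKernel p.1 ∧ (K p.2).snd = PU}),
        ∫⁻ p, (c (p.1, G (z, p.2)) : ℝ≥0∞) ∂K t := by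
  refine le_antisymm (le_iInf₂ fun t ht => conditionalDiscrepancy_le hc PZX hG ht.1 ht.2) ?_
  refine le_iInf fun γ => le_iInf₂ fun hfst hsnd => ?_
  obtain ⟨θ, hθ1, hθ2, hθ⟩ := exists_lift_coupling (hG.comp measurable_prodMk_left) γ hsnd
    (c := fun p => (c p : ℝ≥0∞)) (by fun_prop)
  have hθp : IsProbabilityMeasure θ := ⟨by rw [← Measure.snd_univ, hθ2, measure_univ]⟩
  obtain ⟨t, rfl⟩ := hK θ hθp
  exact (iInf₂_le t ⟨hθ1.trans hfst, hθ2⟩).trans_eq hθ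

/-- A measurable family of couplings of `P_{X|Z=z}` and `P_U` is realised by a stochastic encoder
with aggregated posterior `P_Z ⊗ P_U`. -/
theorem exists_encoder_of_coupling_kernel [StandardBorelSpace 𝒰] [Nonempty 𝒰]
    {c : 𝒳 × 𝒳 → ℝ≥0} (hc : Measurable c) (PZX : Measure (𝒵 × 𝒳)) [IsFiniteMeasure PZX]
    {PU : Measure 𝒰} [IsProbabilityMeasure PU] {G : 𝒵 × 𝒰 → 𝒳} (hG : Measurable G)
    (θ : Kernel 𝒵 (𝒳 × 𝒰)) [IsMarkovKernel θ]
    (hθ : ∀ᵐ z ∂PZX.fst, (θ z).fst = PZX.condKernel z ∧ (θ z).snd = PU) :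
    ∃ Q : Kernel (𝒵 × 𝒳) 𝒰, IsMarkovKernel Q ∧
      aggregatedPosterior PZX Q = PZX.fst.prod PU ∧
      reconstructionError c PZX Q G =
        ∫⁻ z, ∫⁻ p, (c (p.1, G (z, p.2)) : ℝ≥0∞) ∂θ z ∂PZX.fst := by
  -- The first marginal of `θ z` is `P_{X|Z=z}`, so recombining it with the conditional of `θ`
  -- recovers `θ z`.
  have hcomp : ∀ᵐ z ∂PZX.fst, (PZX.condKernel ⊗ₖ θ.condKernel) z = θ z := by
    filter_upwards [hθ] with z hz
    conv_rhs => rw [← θ.disintegrate θ.condKernel]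
    rw [Kernel.compProd_apply_eq_compProd_sectR, Kernel.compProd_apply_eq_compProd_sectR,
      Kernel.fst_apply, ← hz.1]
    rfl
  refine ⟨θ.condKernel, inferInstance, ?_, ?_⟩
  · rw [aggregatedPosterior_eq_compProd, ← Measure.compProd_const]
    refine Measure.compProd_congr ?_
    filter_upwards [hθ, hcomp] with z hz hz'
    rw [Kernel.snd_apply, hz', Kernel.const_apply, ← hz.2]
    rfl
  · rw [reconstructionError_eq_lintegral hc PZX _ hG]
    refine lintegral_congr_ae ?_
    filter_upwards [hcomp] with z hz
    rw [hz]

theorem latentConditionalCost_le_reconstructionError [StandardBorelSpace 𝒰] {c : 𝒳 × 𝒳 → ℝ≥0}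
    (hc : Measurable c) (PZX : Measure (𝒵 × 𝒳)) [IsFiniteMeasure PZX] {PU : Measure 𝒰}
    [IsProbabilityMeasure PU] {G : 𝒵 × 𝒰 → 𝒳} (hG : Measurable G) (Q : Kernel (𝒵 × 𝒳) 𝒰)
    [IsMarkovKernel Q] (hQ : aggregatedPosterior PZX Q = PZX.fst.prod PU) :
    latentConditionalCost c PZX PU G ≤ reconstructionError c PZX Q G := by
  rw [reconstructionError_eq_lintegral hc PZX Q hG]
  rw [aggregatedPosterior_eq_compProd, ← Measure.compProd_const] at hQ
  refine lintegral_mono_ae ?_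
  -- A.e. uniqueness of disintegration: under the constraint, `U` given `Z = z` has law `PU`.
  filter_upwards [Kernel.ae_eq_of_compProd_eq hQ] with z hz
  refine conditionalDiscrepancy_le hc PZX hG ?_ ?_
  · rw [Measure.fst, ← Kernel.fst_apply, Kernel.fst_compProd]
  · rw [Measure.snd, ← Kernel.snd_apply, hz, Kernel.const_apply]

theorem aemeasurable_conditionalDiscrepancy_and_exists_encoder [StandardBorelSpace 𝒰]
    {c : 𝒳 × 𝒳 → ℝ≥0} (hc : Measurable c) (PZX : Measure (𝒵 × 𝒳)) [IsFiniteMeasure PZX]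
    {PU : Measure 𝒰} [IsProbabilityMeasure PU] {G : 𝒵 × 𝒰 → 𝒳} (hG : Measurable G) :
    AEMeasurable (conditionalDiscrepancy c PZX PU G) PZX.fst ∧
      ∀ ε : ℝ≥0∞, ε ≠ 0 → ∃ Q : Kernel (𝒵 × 𝒳) 𝒰, IsMarkovKernel Q ∧
        aggregatedPosterior PZX Q = PZX.fst.prod PU ∧
        reconstructionError c PZX Q G ≤ latentConditionalCost c PZX PU G + ε * PZX univ := by
  have : Nonempty 𝒰 := nonempty_of_isProbabilityMeasure PU
  obtain ⟨K, hKm, hK⟩ := exists_universal_kernel (𝒳 × 𝒰)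
  let F : Set (𝒵 × (ℚ → ℝ)) := {p | (K p.2).fst = PZX.condKernel p.1 ∧ (K p.2).snd = PU}
  have hF : MeasurableSet F :=
    (measurableSet_eq_measure (K.fst.comap Prod.snd measurable_snd)
      (PZX.condKernel.comap Prod.fst measurable_fst) |>.inter
      (measurableSet_eq_measure (K.snd.comap Prod.snd measurable_snd) (Kernel.const _ PU)) :)
  let h : 𝒵 × (ℚ → ℝ) → ℝ≥0∞ := fun q => ∫⁻ p, c (p.1, G (q.1, p.2)) ∂K q.2
  have hh : Measurable h :=
    Measurable.lintegral_kernel_prod_right' (κ := K.comap Prod.snd measurable_snd)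
      (f := fun r : (𝒵 × (ℚ → ℝ)) × (𝒳 × 𝒰) => (c (r.2.1, G (r.1.1, r.2.2)) : ℝ≥0∞))
      (by fun_prop)
  have hV : conditionalDiscrepancy c PZX PU G = fun z => ⨅ (t : ℚ → ℝ) (_ : (z, t) ∈ F), h (z, t) :=
    funext fun z => conditionalDiscrepancy_eq_iInf hc PZX hG hK z
  refine ⟨hV ▸ aemeasurable_iInf_mem _ hF hh, fun ε hε => ?_⟩
  have hne : ∀ z, ∃ t, (z, t) ∈ F := fun z => by
    -- The independent coupling is always feasible.
    obtain ⟨t, ht⟩ := hK ((PZX.condKernel z).prod PU) inferInstance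
    exact ⟨t, by simp [F, ht]⟩
  obtain ⟨s, hs, hsF⟩ := exists_measurable_near_minimizer PZX.fst hF hne hh hε
  obtain ⟨Q, hQm, hQ, hQe⟩ := exists_encoder_of_coupling_kernel hc PZX hG (K.comap s hs)
    (PU := PU) (hsF.mono fun z hz => hz.1)
  refine ⟨Q, hQm, hQ, ?_⟩
  rw [hQe, latentConditionalCost, ← Measure.fst_univ, ← lintegral_const,
    ← lintegral_add_right _ measurable_const, hV]
  exact lintegral_mono_ae (hsF.mono fun z hz => hz.2)

end LatentCost

end CWAE

theorem mainTheorem2 {𝒴 𝒳 𝒵 𝒰 : Type*}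
    [MeasurableSpace 𝒴] [MeasurableSpace 𝒵]
    [MeasurableSpace 𝒳] [StandardBorelSpace 𝒳] [Nonempty 𝒳]
    [MeasurableSpace 𝒰] [StandardBorelSpace 𝒰]
    (P : Measure (𝒴 × 𝒳)) [IsProbabilityMeasure P]
    (PU : Measure 𝒰) [IsProbabilityMeasure PU]
    (c : 𝒳 × 𝒳 → ℝ≥0) (hc : Measurable c)
    (Φ : 𝒴 → 𝒵) (hΦ : Measurable Φ)
    (G : 𝒵 × 𝒰 → 𝒳) (hG : Measurable G) :
    AEMeasurable (CWAE.conditionalDiscrepancy c (CWAE.latentCoupling P Φ) PU G)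
        (CWAE.latentCoupling P Φ).fst ∧
      CWAE.latentConditionalCost c (CWAE.latentCoupling P Φ) PU G =
        ⨅ (Q : Kernel (𝒵 × 𝒳) 𝒰) (_ : IsMarkovKernel Q)
          (_ : CWAE.aggregatedPosterior (CWAE.latentCoupling P Φ) Q =
            (CWAE.latentCoupling P Φ).fst.prod PU),
          CWAE.reconstructionError c (CWAE.latentCoupling P Φ) Q G := by
  obtain ⟨hmeas, hex⟩ := CWAE.aemeasurable_conditionalDiscrepancy_and_exists_encoder hc
    (CWAE.latentCoupling P Φ) (PU := PU) hG
  have hprob : IsProbabilityMeasure (CWAE.latentCoupling P Φ) :=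
    Measure.isProbabilityMeasure_map (by fun_prop)
  refine ⟨hmeas, le_antisymm ?_ (ENNReal.le_of_forall_pos_le_add fun ε hε _ => ?_)⟩
  · exact le_iInf fun Q => le_iInf₂ fun hQm hQ =>
      CWAE.latentConditionalCost_le_reconstructionError hc _ hG Q hQ
  · obtain ⟨Q, hQm, hQ, hle⟩ := hex ε (by exact_mod_cast hε.ne')
    refine (iInf_le_of_le Q (iInf₂_le hQm hQ)).trans ?_
    simpa using hle
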